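/- Let $f,g_i,h_j,G_l,H_l\colon\mathbb R^n\to\mathbb R$ ($i\in\{1,\dots,m\}$, $j\in\{1,\dots,p\}$, $l\in\{1,\dots,q\}$) be continuously differentiable, and consider the mathematical program with switching constraints $$\text{(MPSC)}\qquad \min f(x)\quad\text{s.t.}\quad g_i(x)\le 0\ \ \forall i,\qquad h_j(x)=0\ \ \forall j,\qquad G_l(x)H_l(x)=0\ \ \forall l.$$ Define $\varphi\colon\mathbb R^2\to\mathbb R$ by $\varphi(a,b):=ab$ if $a+b\ge 0$ and $\varphi(a,b):=-\tfrac12(a^2+b^2)$ if $a+b<0$. For $t>0$ let $$\begin{aligned}\Phi^1_l(x;t)&:=\varphi(G_l(x)-t,H_l(x)-t),&\Phi^2_l(x;t)&:=\varphi(-G_l(x)-t,H_l(x)-t),\\ \Phi^3_l(x;t)&:=\varphi(-G_l(x)-t,-H_l(x)-t),&\Phi^4_l(x;t)&:=\varphi(G_l(x)-t,-H_l(x)-t),\end{aligned}$$ and let $P(t)$ be the nonlinear program $$\min f(x)\quad\text{s.t.}\quad g_i(x)\le 0\ \ \forall i,\qquad h_j(x)=0\ \ \forall j,\qquad \Phi^s_l(x;t)\le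 0\ \ \forall s\in\{1,2,3,4\},\ \forall l,$$ with feasible set $X(t)$. For a feasible point $\bar x$ of (MPSC), MPSC-LICQ is said to hold at $\bar x$ if the family consisting of the gradients $\nabla g_i(\bar x)$ for all $i$ with $g_i(\bar x)=0$, $\nabla h_j(\bar x)$ for all $j$, $\nabla G_l(\bar x)$ for all $l$ with $G_l(\bar x)=0$, and $\nabla H_l(\bar x)$ for all $l$ with $H_l(\bar x)=0$ is linearly independent (that is, if the linear independence constraint qualification holds at $\bar x$ for the nonlinear program obtained by replacing the switching constraints by the equations $G_l(x)=0$ for all $l$ with $G_l(\bar x)=0$ and $H_l(x)=0$ for all $l$ with $H_l(\bar x)=0$). For a nonlinear program with finitely many continuously differentiable inequality constraints $c_i(x)\le 0$ and equality constraints $e_j(x)=0$, with feasible set $\tilde X$, and for $x\in\tilde X$, let $$\mathcal T_{\tilde X}(x):=\{d\in\mathbb R^n \mid \exists\, x_k\in\tilde X,\ \tau_k>0\colon\ x_k\to x,\ \tau_k\to 0,\ (x_k-x)/\tau_k\to d\},$$ $$\mathcal L_{\tilde X}(x):=\{d\in\mathbb R^n \mid \nabla c_i(x)\cdot d\le 0\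 \text{ for all } i \text{ with } c_i(x)=0,\ \ \nabla e_j(x)\cdot d=0\ \text{ for all } j\},$$ and $A^\circ:=\{y\in\mathbb R^n \mid x\cdot y\le 0\ \ \forall x\in A\}$. The Guignard constraint qualification (GCQ) holds at $x$ if $\mathcal T_{\tilde X}(x)^\circ=\mathcal L_{\tilde X}(x)^\circ$. **Theorem.** Let $\bar x$ be a feasible point of (MPSC) at which MPSC-LICQ holds. Then there exist $\bar t>0$ and a neighborhood $U\subset\mathbb R^n$ of $\bar x$ such that, for every $t\in(0,\bar t]$ and every $x\in X(t)\cap U$, GCQ holds for $P(t)$ at $x$. -/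

import Mathlib

open Filter Topology

/-- The polar cone `A° = {y | x ⬝ y ≤ 0 for all x ∈ A}`. -/
def polarCone {n : ℕ} (A : Set (EuclideanSpace ℝ (Fin n))) : Set (EuclideanSpace ℝ (Fin n)) :=
  {y | ∀ x ∈ A, inner ℝ x y ≤ 0}

/-- The tangent (Bouligand) cone to `A` at `x`: all limits of `(x_k - x) / τ_k` with `x_k ∈ A`,
`x_k → x` and `0 < τ_k → 0`. -/
def bouligandCone {n : ℕ} (A : Set (EuclideanSpace ℝ (Fin n))) (x : EuclideanSpace ℝ (Fin n)) :
    Set (EuclideanSpace ℝ (Fin n)) :=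
  {d | ∃ (y : ℕ → EuclideanSpace ℝ (Fin n)) (τ : ℕ → ℝ),
    (∀ k, y k ∈ A) ∧ (∀ k, 0 < τ k) ∧ Tendsto y atTop (𝓝 x) ∧ Tendsto τ atTop (𝓝 0) ∧
    Tendsto (fun k => (τ k)⁻¹ • (y k - x)) atTop (𝓝 d)}

/-- The data of a standard nonlinear program on `ℝⁿ`: minimize `f` subject to `g i ≤ 0` (`i : ι`)
and `h j = 0` (`j : κ`). -/
structure NLP (n : ℕ) (ι κ : Type) where
  /-- objective function -/
  f : EuclideanSpace ℝ (Fin n) → ℝ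
  /-- inequality constraints -/
  g : ι → EuclideanSpace ℝ (Fin n) → ℝ
  /-- equality constraints -/
  h : κ → EuclideanSpace ℝ (Fin n) → ℝ

namespace NLP

variable {n : ℕ} {ι κ : Type}

/-- The feasible set. -/
def feasibleSet (N : NLP n ι κ) : Set (EuclideanSpace ℝ (Fin n)) :=
  {x | (∀ i, N.g i x ≤ 0) ∧ ∀ j, N.h j x = 0}

/-- The index set of active inequality constraints at `x`. -/
def activeSet (N : NLP n ι κ) (x : EuclideanSpace ℝ (Fin n)) : Set ι :=
  {i | N.g i x = 0}

/-- The linearization cone at `x`. -/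
noncomputable def linearizationCone (N : NLP n ι κ) (x : EuclideanSpace ℝ (Fin n)) :
    Set (EuclideanSpace ℝ (Fin n)) :=
  {d | (∀ i ∈ N.activeSet x, inner ℝ (gradient (N.g i) x) d ≤ 0) ∧
    ∀ j, inner ℝ (gradient (N.h j) x) d = 0}

/-- LICQ at `x`: the family of the gradients of all active inequality constraints and of all
equality constraints is linearly independent. -/
def LICQ (N : NLP n ι κ) (x : EuclideanSpace ℝ (Fin n)) : Prop :=
  LinearIndependent ℝ
    (Sum.elim (fun i : N.activeSet x => gradient (N.g i) x) (fun j : κ => gradient (N.h j) x))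

/-- Guignard CQ at `x`: the tangent cone and the linearization cone have the same polar cone. -/
def GCQ (N : NLP n ι κ) (x : EuclideanSpace ℝ (Fin n)) : Prop :=
  polarCone (bouligandCone N.feasibleSet x) = polarCone (N.linearizationCone x)

end NLP

/-- The data of a mathematical program with switching constraints on `ℝⁿ`: minimize `f` subject to
`g i ≤ 0`, `h j = 0` and `G l * H l = 0`. -/
structure MPSC (n m p q : ℕ) where
  /-- objective function -/
  f : EuclideanSpace ℝ (Fin n) → ℝ
  /-- inequality constraints -/
  g : Fin m → EuclideanSpace ℝ (Fin n) → ℝ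
  /-- equality constraints -/
  h : Fin p → EuclideanSpace ℝ (Fin n) → ℝ
  /-- first factors of the switching constraints -/
  G : Fin q → EuclideanSpace ℝ (Fin n) → ℝ
  /-- second factors of the switching constraints -/
  H : Fin q → EuclideanSpace ℝ (Fin n) → ℝ

/-- The function `φ(a,b) = ab` if `a + b ≥ 0`, and `-(a² + b²)/2` if `a + b < 0`. -/
noncomputable def switchPhi (a b : ℝ) : ℝ :=
  if 0 ≤ a + b then a * b else -(1 / 2) * (a ^ 2 + b ^ 2)

namespace MPSC

variable {n m p q : ℕ}

/-- All functions of the program are continuously differentiable. -/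
def IsC1 (P : MPSC n m p q) : Prop :=
  ContDiff ℝ 1 P.f ∧ (∀ i, ContDiff ℝ 1 (P.g i)) ∧ (∀ j, ContDiff ℝ 1 (P.h j)) ∧
    (∀ l, ContDiff ℝ 1 (P.G l)) ∧ ∀ l, ContDiff ℝ 1 (P.H l)

/-- The feasible set `X`. -/
def feasibleSet (P : MPSC n m p q) : Set (EuclideanSpace ℝ (Fin n)) :=
  {x | (∀ i, P.g i x ≤ 0) ∧ (∀ j, P.h j x = 0) ∧ ∀ l, P.G l x * P.H l x = 0}

/-- `I^G(x)`. -/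
def IG (P : MPSC n m p q) (x : EuclideanSpace ℝ (Fin n)) : Set (Fin q) :=
  {l | P.G l x = 0 ∧ P.H l x ≠ 0}

/-- `I^H(x)`. -/
def IH (P : MPSC n m p q) (x : EuclideanSpace ℝ (Fin n)) : Set (Fin q) :=
  {l | P.G l x ≠ 0 ∧ P.H l x = 0}

/-- `I^{GH}(x)`. -/
def IGH (P : MPSC n m p q) (x : EuclideanSpace ℝ (Fin n)) : Set (Fin q) :=
  {l | P.G l x = 0 ∧ P.H l x = 0}

/-- The tightened nonlinear problem at `xbar`: the switching constraints are replaced by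
`G l = 0` for `l ∈ I^G ∪ I^{GH}` and `H l = 0` for `l ∈ I^H ∪ I^{GH}`. -/
def tightened (P : MPSC n m p q) (xbar : EuclideanSpace ℝ (Fin n)) :
    NLP n (Fin m)
      (Fin p ⊕ (↥(P.IG xbar ∪ P.IGH xbar) ⊕ ↥(P.IH xbar ∪ P.IGH xbar))) where
  f := P.f
  g := P.g
  h := Sum.elim P.h
    (Sum.elim (fun l : ↥(P.IG xbar ∪ P.IGH xbar) => P.G l)
      (fun l : ↥(P.IH xbar ∪ P.IGH xbar) => P.H l))

/-- MPSC-LICQ at `xbar`: LICQ holds for the tightened nonlinear problem at `xbar`. -/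
def MPSCLICQ (P : MPSC n m p q) (xbar : EuclideanSpace ℝ (Fin n)) : Prop :=
  (P.tightened xbar).LICQ xbar

/-- The functions `Φ^s_l(x; t)`; the four values of `s` correspond to the four quadrants. -/
noncomputable def Phi (P : MPSC n m p q) (t : ℝ) (s : Fin 4) (l : Fin q)
    (x : EuclideanSpace ℝ (Fin n)) : ℝ :=
  match s with
  | 0 => switchPhi (P.G l x - t) (P.H l x - t)
  | 1 => switchPhi (-P.G l x - t) (P.H l x - t)
  | 2 => switchPhi (-P.G l x - t) (-P.H l x - t)
  | 3 => switchPhi (P.G l x - t) (-P.H l x - t)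

/-- The relaxed problem `P(t)`: the inequality constraints are `g i ≤ 0` and `Φ^s_l(·; t) ≤ 0`,
the equality constraints are `h j = 0`. -/
noncomputable def relaxed (P : MPSC n m p q) (t : ℝ) :
    NLP n (Fin m ⊕ (Fin 4 × Fin q)) (Fin p) where
  f := P.f
  g := Sum.elim P.g (fun sl => P.Phi t sl.1 sl.2)
  h := P.h

end MPSC

/-! Since φ(a,b) > 0 exactly when a and b are both positive, the four constraints Φ^s_l ≤ 0 together
say that |G_l| ≤ t or |H_l| ≤ t. Where |G_l| = t < |H_l| (or the reverse) the linearization sees the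
correct half-space. At a corner |G_l| = |H_l| = t the gradient of the active Φ^s_l vanishes, so the
linearization ignores l, while the tangent cone is still restricted and in general not convex. GCQ
only asks that the polars agree, so it suffices that every linearized direction d is a midpoint of
two tangent directions.

These are d + v and d - v, where v satisfies ∇G_l·v = -∇G_l·d and ∇H_l·v = ∇H_l·d at corner indices
and is orthogonal to the other relevant active gradients. Then d + v freezes G_l and d - v freezes
H_l to first order. Linear independence provides v (`exists_inner_eq_of_linearIndependent`) and
turns first-order feasibility into exact curves (`exists_curve_of_linearIndependent`). It persists
near xbar, and for small t only functions vanishing at xbar can reach |G_l| = t or |H_l| = t, so the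
MPSC-LICQ family covers all of them. -/

section General

variable {n : ℕ}

local notation "E" => EuclideanSpace ℝ (Fin n)

/-! ### Tangent cones, linear independence and curves -/

theorem inner_gradient_eq_fderiv {c : E → ℝ} {x : E} (hc : DifferentiableAt ℝ c x) (d : E) :
    inner ℝ (gradient c x) d = fderiv ℝ c x d := by
  have h := hc.hasGradientAt.hasFDerivAt.fderiv
  rw [h]
  simp

theorem polarCone_anti {A B : Set E} (h : A ⊆ B) : polarCone B ⊆ polarCone A :=
  fun _ hy x hx => hy x (h hx)

/-- Difference quotients of a differentiable function along a tangential sequence. -/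
theorem tendsto_quotient_of_hasFDerivAt {c : E → ℝ} {x d : E} (hc : DifferentiableAt ℝ c x)
    {y : ℕ → E} {τ : ℕ → ℝ} (hτ : ∀ k, 0 < τ k) (hτ0 : Tendsto τ atTop (𝓝 0))
    (hd : Tendsto (fun k => (τ k)⁻¹ • (y k - x)) atTop (𝓝 d)) :
    Tendsto (fun k => (τ k)⁻¹ * (c (y k) - c x)) atTop (𝓝 (inner ℝ (gradient c x) d)) := by
  rw [inner_gradient_eq_fderiv hc]
  have hy0 : Tendsto (fun k => y k - x) atTop (𝓝 0) := by
    have h := hτ0.smul hd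
    rw [zero_smul] at h
    refine h.congr fun k => ?_
    rw [smul_smul, mul_inv_cancel₀ (hτ k).ne', one_smul]
  have h := (hasFDerivWithinAt_univ.2 hc.hasFDerivAt).lim hy0
    (Eventually.of_forall fun _ => Set.mem_univ _) hd
  simpa using h

theorem bouligandCone_subset_linearizationCone {ι κ : Type} (N : NLP n ι κ) {x : E}
    (hx : x ∈ N.feasibleSet) (hg : ∀ i ∈ N.activeSet x, DifferentiableAt ℝ (N.g i) x)
    (hh : ∀ j, DifferentiableAt ℝ (N.h j) x) :
    bouligandCone N.feasibleSet x ⊆ N.linearizationCone x := by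
  rintro d ⟨y, τ, hy, hτ, -, hτ0, hd⟩
  refine ⟨fun i hi => ?_, fun j => ?_⟩
  · refine le_of_tendsto (tendsto_quotient_of_hasFDerivAt (hg i hi) hτ hτ0 hd)
      (Eventually.of_forall fun k => ?_)
    have hi' : N.g i x = 0 := hi
    rw [hi', sub_zero]
    exact mul_nonpos_of_nonneg_of_nonpos (inv_nonneg.2 (hτ k).le) ((hy k).1 i)
  · refine tendsto_nhds_unique (tendsto_quotient_of_hasFDerivAt (hh j) hτ hτ0 hd) ?_
    simp [(hy _).2 j, hx.2 j]

theorem mem_bouligandCone_of_curve {A : Set E} {x d : E} {z : ℝ → E} (hz0 : z 0 = x)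
    (hz : HasDerivAt z d 0) (hA : ∀ᶠ τ in 𝓝[>] (0 : ℝ), z τ ∈ A) : d ∈ bouligandCone A x := by
  have hlim : Tendsto (fun k : ℕ => 1 / ((k : ℝ) + 1)) atTop (𝓝[>] 0) :=
    tendsto_nhdsWithin_iff.2 ⟨tendsto_one_div_add_atTop_nhds_zero_nat,
      Eventually.of_forall fun k => Set.mem_Ioi.2 (by positivity)⟩
  -- The curve lies in `A` only for small parameters, whereas the cone asks for every term; hence
  -- the shift by `N`.
  obtain ⟨N, hN⟩ := eventually_atTop.1 (hlim.eventually hA)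
  have hlim' := hlim.comp (tendsto_add_atTop_nat N)
  have hlim0 := (tendsto_nhdsWithin_iff.1 hlim').1
  refine ⟨fun k => z (1 / (((k + N : ℕ) : ℝ) + 1)), fun k => 1 / (((k + N : ℕ) : ℝ) + 1),
    fun k => hN _ (Nat.le_add_left N k), fun k => by positivity, ?_, hlim0, ?_⟩
  · have h := hz.continuousAt.tendsto.comp hlim0
    rwa [hz0] at h
  · have hs := hz.tendsto_slope_zero_right.comp hlim'
    simpa [Function.comp_def, hz0] using hs

theorem exists_inner_eq_of_linearIndependent {I : Type} [Finite I] {a : I → E}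
    (ha : LinearIndependent ℝ a) (w : I → ℝ) : ∃ v : E, ∀ i, inner ℝ (a i) v = w i := by
  have := Fintype.ofFinite I
  let f : Submodule.span ℝ (Set.range a) →ₗ[ℝ] ℝ := (Module.Basis.span ha).constr ℝ w
  obtain ⟨g, hg⟩ := LinearMap.exists_extend f
  refine ⟨(InnerProductSpace.toDual ℝ E).symm (LinearMap.toContinuousLinearMap g), fun i => ?_⟩
  rw [real_inner_comm, InnerProductSpace.toDual_symm_apply]
  have h1 : g (a i) = f ⟨a i, Submodule.subset_span ⟨i, rfl⟩⟩ := by rw [← hg]; rfl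
  have h2 : (⟨a i, Submodule.subset_span ⟨i, rfl⟩⟩ : Submodule.span ℝ (Set.range a))
      = Module.Basis.span ha i := by
    exact (Module.Basis.span_apply ha i).symm
  change g (a i) = w i
  rw [h1, h2]
  exact (Module.Basis.span ha).constr_basis ℝ w i

/-- If the gradients of `c i` at `x` are linearly independent, then every direction is realized by
a curve along which all `c i` are affine in the parameter. -/
theorem exists_curve_of_linearIndependent {I : Type} [Finite I] {c : I → E → ℝ} {x : E}
    (hc : ∀ i, ContDiff ℝ 1 (c i)) (hli : LinearIndependent ℝ fun i => gradient (c i) x) (d : E) :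
    ∃ z : ℝ → E, z 0 = x ∧ HasDerivAt z d 0 ∧
      ∀ᶠ τ in 𝓝 (0 : ℝ), ∀ i, c i (z τ) = c i x + τ * inner ℝ (gradient (c i) x) d := by
  have := Fintype.ofFinite I
  have hdiff : ∀ i, DifferentiableAt ℝ (c i) x := fun i => (hc i).differentiable one_ne_zero x
  let F : E → I → ℝ := fun y i => c i y
  let F' : E →L[ℝ] (I → ℝ) := ContinuousLinearMap.pi fun i => fderiv ℝ (c i) x
  have hF : HasStrictFDerivAt F F' x :=
    hasStrictFDerivAt_pi.2 fun i => (hc i).contDiffAt.hasStrictFDerivAt one_ne_zero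
  have hsurj : LinearMap.range (F' : E →ₗ[ℝ] (I → ℝ)) = ⊤ := by
    refine LinearMap.range_eq_top.2 fun w => ?_
    obtain ⟨v, hv⟩ := exists_inner_eq_of_linearIndependent hli w
    refine ⟨v, funext fun i => ?_⟩
    rw [← hv i, inner_gradient_eq_fderiv (hdiff i)]
    rfl
  obtain ⟨R0, hR0⟩ := LinearMap.exists_rightInverse_of_surjective _ hsurj
  let R : (I → ℝ) →L[ℝ] E := LinearMap.toContinuousLinearMap R0
  have hR : ∀ w, F' (R w) = w := fun w => LinearMap.congr_fun hR0 w
  -- `Θ` straightens `F`: since `F' ∘ R = id`, one has `F' (Θ y) = F y`. Its derivative at `x` is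
  -- `id + R (F' - F') = id`, so it is locally invertible and the curve is the preimage of the line
  -- `Θ x + τ • d`.
  let Θ : E → E := fun y => y + R (F y - F' y)
  have hΘ : HasStrictFDerivAt Θ ((ContinuousLinearEquiv.refl ℝ E : E ≃L[ℝ] E) : E →L[ℝ] E) x := by
    have h := (hasStrictFDerivAt_id x).add
      (R.hasStrictFDerivAt.comp x (hF.sub F'.hasStrictFDerivAt))
    refine h.congr_fderiv ?_
    ext1 v
    simp
  let θ := hΘ.localInverse Θ _ x
  have hθx : θ (Θ x) = x := hΘ.localInverse_apply_image
  have hθd : HasFDerivAt θ (ContinuousLinearMap.id ℝ E) (Θ x) := hΘ.to_localInverse.hasFDerivAt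
  have hline : HasDerivAt (fun τ : ℝ => Θ x + τ • d) d 0 := by
    simpa using ((hasDerivAt_id (0 : ℝ)).smul_const d).const_add (Θ x)
  have hline0 : Θ x + (0 : ℝ) • d = Θ x := by simp
  refine ⟨fun τ => θ (Θ x + τ • d), by simpa using hθx, ?_, ?_⟩
  · have h : HasFDerivAt θ (ContinuousLinearMap.id ℝ E) (Θ x + (0 : ℝ) • d) := by rwa [hline0]
    exact h.comp_hasDerivAt (0 : ℝ) hline
  · have hcont : Tendsto (fun τ : ℝ => Θ x + τ • d) (𝓝 0) (𝓝 (Θ x)) := by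
      simpa using hline.continuousAt.tendsto
    filter_upwards [hcont.eventually hΘ.eventually_right_inverse] with τ hτ i
    have h1 : θ (Θ x + τ • d) + R (F (θ (Θ x + τ • d)) - F' (θ (Θ x + τ • d)))
        = x + R (F x - F' x) + τ • d := hτ
    have h2 := congrArg F' h1
    simp only [map_add, hR, map_smul] at h2
    have h3 := congrFun h2 i
    simp only [Pi.add_apply, Pi.sub_apply, Pi.smul_apply, smul_eq_mul] at h3
    have h4 : F' d i = inner ℝ (gradient (c i) x) d := by
      rw [inner_gradient_eq_fderiv (hdiff i)]; rfl
    rw [h4] at h3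
    have h5 : ∀ y, F y i = c i y := fun _ => rfl
    rw [h5, h5] at h3
    linarith

theorem eventually_linearIndependent_gradient {I : Type} [Finite I] {c : I → E → ℝ} {x : E}
    (hc : ∀ i, ContDiff ℝ 1 (c i)) (hli : LinearIndependent ℝ fun i => gradient (c i) x) :
    ∀ᶠ y in 𝓝 x, LinearIndependent ℝ fun i => gradient (c i) y := by
  have hcont : Continuous fun y => fun i => gradient (c i) y :=
    continuous_pi fun i => (InnerProductSpace.toDual ℝ E).symm.continuous.comp
      ((hc i).continuous_fderiv one_ne_zero)
  exact hcont.continuousAt.eventually hli.eventually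

/-- The sign condition moves `u` towards zero, and for small `τ` it cannot change sign. This
suffices because `G l` and `H l` are exactly affine along the curves used. -/
theorem eventually_abs_add_mul_le {u e t : ℝ} (ht : 0 < t) (hu : |u| = t) (hue : u * e ≤ 0) :
    ∀ᶠ τ in 𝓝[>] (0 : ℝ), |u + τ * e| ≤ t := by
  have hlim : Tendsto (fun τ : ℝ => u * (u + τ * e)) (𝓝[>] 0) (𝓝 (u * (u + 0 * e))) :=
    (Continuous.tendsto (by fun_prop) 0).mono_left nhdsWithin_le_nhds
  have hpos : 0 < u * (u + 0 * e) := by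
    have : u ≠ 0 := by rintro rfl; simp at hu; exact ht.ne hu
    simpa using mul_self_pos.2 this
  filter_upwards [hlim.eventually (lt_mem_nhds hpos), self_mem_nhdsWithin] with τ h1 h2
  have h2' : 0 < τ := h2
  rcases (abs_eq ht.le).1 hu with rfl | rfl
  · have he : e ≤ 0 := by nlinarith
    have hp : 0 < u + τ * e := pos_of_mul_pos_right h1 ht.le
    rw [abs_of_pos hp]
    nlinarith
  · have he : 0 ≤ e := by nlinarith
    have hp : -t + τ * e < 0 := by nlinarith
    rw [abs_of_neg hp]
    nlinarith

end General

/-! ### Sign and derivatives of φ -/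

theorem switchPhi_comm (a b : ℝ) : switchPhi a b = switchPhi b a := by
  simp only [switchPhi, add_comm a b, add_comm (a ^ 2), mul_comm a b]

theorem switchPhi_nonpos_iff {a b : ℝ} : switchPhi a b ≤ 0 ↔ a ≤ 0 ∨ b ≤ 0 := by
  unfold switchPhi
  split_ifs with h
  · constructor
    · intro hab
      by_contra! hc
      exact absurd hab (not_le.2 (mul_pos hc.1 hc.2))
    · rintro (ha | hb)
      · exact mul_nonpos_of_nonpos_of_nonneg ha (by linarith)
      · exact mul_nonpos_of_nonneg_of_nonpos (by linarith) hb
  · refine ⟨fun _ => ?_, fun _ => by nlinarith [sq_nonneg a, sq_nonneg b]⟩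
    by_contra! hc
    linarith

/-- The zero set is the boundary of the positive quadrant: two open edges, where φ is locally the
product, and the corner, where its gradient is zero. -/
theorem switchPhi_eq_zero {a b : ℝ} (h : switchPhi a b = 0) :
    (a = 0 ∧ 0 < b) ∨ (0 < a ∧ b = 0) ∨ (a = 0 ∧ b = 0) := by
  unfold switchPhi at h
  split_ifs at h with hab
  · rcases mul_eq_zero.1 h with rfl | rfl
    · rcases (show 0 ≤ b by linarith).eq_or_lt with hb | hb
      · exact Or.inr (Or.inr ⟨rfl, hb.symm⟩)
      · exact Or.inl ⟨rfl, hb⟩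
    · rcases (show 0 ≤ a by linarith).eq_or_lt with ha | ha
      · exact Or.inr (Or.inr ⟨ha.symm, rfl⟩)
      · exact Or.inr (Or.inl ⟨ha, rfl⟩)
  · have ha : a = 0 := by nlinarith [sq_nonneg a, sq_nonneg b]
    have hb : b = 0 := by nlinarith [sq_nonneg a, sq_nonneg b]
    exact Or.inr (Or.inr ⟨ha, hb⟩)

theorem switchPhi_zero_left {b : ℝ} (hb : 0 ≤ b) : switchPhi 0 b = 0 := by
  simp [switchPhi, hb]

theorem abs_switchPhi_le (a b : ℝ) : |switchPhi a b| ≤ a ^ 2 + b ^ 2 := by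
  unfold switchPhi
  split_ifs <;> rw [abs_le] <;> constructor <;>
    nlinarith [sq_nonneg (a + b), sq_nonneg (a - b), sq_nonneg a, sq_nonneg b]

section SwitchPhi

variable {n : ℕ}

local notation "E" => EuclideanSpace ℝ (Fin n)

theorem hasGradientAt_switchPhi_left {a b : E → ℝ} {x : E} (ha : DifferentiableAt ℝ a x)
    (hb : DifferentiableAt ℝ b x) (ha0 : a x = 0) (hb0 : 0 < b x) :
    HasGradientAt (fun y => switchPhi (a y) (b y)) (b x • gradient a x) x := by
  have hmul : HasGradientAt (fun y => a y * b y) (b x • gradient a x) x := by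
    rw [hasGradientAt_iff_hasFDerivAt]
    refine (ha.hasGradientAt.hasFDerivAt.mul hb.hasFDerivAt).congr_fderiv ?_
    simp [ha0]
  have hpos : ∀ᶠ y in 𝓝 x, 0 < a y + b y :=
    (ha.continuousAt.add hb.continuousAt).eventually (lt_mem_nhds (by simpa [ha0] using hb0))
  refine HasFDerivAt.congr_of_eventuallyEq hmul ?_
  filter_upwards [hpos] with y hy
  simp [switchPhi, hy.le]

/-- Near the corner φ is quadratically small in `(a, b)`, hence `O(‖y - x‖ ^ 2)` after composition.
-/
theorem hasGradientAt_switchPhi_zero {a b : E → ℝ} {x : E} (ha : DifferentiableAt ℝ a x)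
    (hb : DifferentiableAt ℝ b x) (ha0 : a x = 0) (hb0 : b x = 0) :
    HasGradientAt (fun y => switchPhi (a y) (b y)) 0 x := by
  rw [hasGradientAt_iff_hasFDerivAt, map_zero]
  refine Asymptotics.IsBigO.hasFDerivAt (n := 2) ?_ one_lt_two
  have ha' : a =O[𝓝 x] fun y => ‖y - x‖ := by
    simpa [ha0] using ha.hasFDerivAt.isBigO_sub.norm_right
  have hb' : b =O[𝓝 x] fun y => ‖y - x‖ := by
    simpa [hb0] using hb.hasFDerivAt.isBigO_sub.norm_right
  refine Asymptotics.IsBigO.trans ?_ ((ha'.pow 2).add (hb'.pow 2))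
  refine Asymptotics.IsBigO.of_bound 1 (Eventually.of_forall fun y => ?_)
  rw [one_mul, Real.norm_eq_abs, Real.norm_eq_abs]
  exact (abs_switchPhi_le _ _).trans (le_abs_self _)

theorem differentiableAt_switchPhi {a b : E → ℝ} {x : E} (ha : DifferentiableAt ℝ a x)
    (hb : DifferentiableAt ℝ b x) (h : switchPhi (a x) (b x) = 0) :
    DifferentiableAt ℝ (fun y => switchPhi (a y) (b y)) x := by
  rcases switchPhi_eq_zero h with ⟨h1, h2⟩ | ⟨h1, h2⟩ | ⟨h1, h2⟩
  · exact (hasGradientAt_switchPhi_left ha hb h1 h2).differentiableAt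
  · simp only [switchPhi_comm (a _)]
    exact (hasGradientAt_switchPhi_left hb ha h2 h1).differentiableAt
  · exact (hasGradientAt_switchPhi_zero ha hb h1 h2).differentiableAt

theorem inner_gradient_nonpos_of_switchPhi {a b : E → ℝ} {x d : E} (ha : DifferentiableAt ℝ a x)
    (hb : DifferentiableAt ℝ b x) (ha0 : a x = 0) (hb0 : 0 < b x)
    (h : inner ℝ (gradient (fun y => switchPhi (a y) (b y)) x) d ≤ 0) :
    fderiv ℝ a x d ≤ 0 := by
  rw [(hasGradientAt_switchPhi_left ha hb ha0 hb0).gradient, real_inner_smul_left,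
    inner_gradient_eq_fderiv ha] at h
  exact nonpos_of_mul_nonpos_right h hb0

end SwitchPhi

/-! ### The relaxed switching constraints and their linearization -/

namespace MPSC

variable {n m p q : ℕ}

/-- Each `s` removes one open quadrant of the `(G, H)`-plane, shifted away from the origin when `t >
0`; the four together form the region `|G| > t`, `|H| > t`. -/
theorem Phi_nonpos_iff (P : MPSC n m p q) {t : ℝ} (l : Fin q)
    (x : EuclideanSpace ℝ (Fin n)) :
    (∀ s, P.Phi t s l x ≤ 0) ↔ |P.G l x| ≤ t ∨ |P.H l x| ≤ t := by
  have h : (∀ s, P.Phi t s l x ≤ 0) ↔ P.Phi t 0 l x ≤ 0 ∧ P.Phi t 1 l x ≤ 0 ∧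
      P.Phi t 2 l x ≤ 0 ∧ P.Phi t 3 l x ≤ 0 :=
    ⟨fun h => ⟨h 0, h 1, h 2, h 3⟩, fun ⟨h0, h1, h2, h3⟩ s => by fin_cases s <;> assumption⟩
  rw [h]
  simp only [Phi, switchPhi_nonpos_iff, abs_le]
  grind

theorem differentiableAt_Phi (P : MPSC n m p q) {t : ℝ} {s : Fin 4} {l : Fin q}
    {x : EuclideanSpace ℝ (Fin n)} (hG : DifferentiableAt ℝ (P.G l) x)
    (hH : DifferentiableAt ℝ (P.H l) x) (h : P.Phi t s l x = 0) :
    DifferentiableAt ℝ (P.Phi t s l) x := by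
  fin_cases s
  · exact differentiableAt_switchPhi (hG.sub_const t) (hH.sub_const t) h
  · exact differentiableAt_switchPhi (hG.neg.sub_const t) (hH.sub_const t) h
  · exact differentiableAt_switchPhi (hG.neg.sub_const t) (hH.neg.sub_const t) h
  · exact differentiableAt_switchPhi (hG.sub_const t) (hH.neg.sub_const t) h

/-- The directional sign condition that the linearized relaxed switching constraints impose on
`G l` at a point of the boundary `|G l| = t`, `|H l| > t`. -/
theorem G_mul_inner_nonpos (P : MPSC n m p q) {t : ℝ} (ht : 0 < t) {l : Fin q}
    {x d : EuclideanSpace ℝ (Fin n)} (hG : DifferentiableAt ℝ (P.G l) x)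
    (hH : DifferentiableAt ℝ (P.H l) x)
    (hd : d ∈ (P.relaxed t).linearizationCone x) (hGt : |P.G l x| = t) (hHt : t < |P.H l x|) :
    P.G l x * inner ℝ (gradient (P.G l) x) d ≤ 0 := by
  have hs : ∀ s, P.Phi t s l x = 0 → inner ℝ (gradient (P.Phi t s l) x) d ≤ 0 :=
    fun s h => hd.1 (Sum.inr (s, l)) h
  rw [inner_gradient_eq_fderiv hG]
  rcases (abs_eq ht.le).1 hGt with h1 | h1 <;> rcases lt_abs.1 hHt with h2 | h2
  · have h := inner_gradient_nonpos_of_switchPhi (hG.sub_const t) (hH.sub_const t)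
      (sub_eq_zero.2 h1) (sub_pos.2 h2) (hs 0 (by simp [Phi, h1, switchPhi_zero_left, h2.le]))
    rw [fderiv_sub_const] at h
    nlinarith
  · have h := inner_gradient_nonpos_of_switchPhi (hG.sub_const t) (hH.neg.sub_const t)
      (sub_eq_zero.2 h1) (sub_pos.2 h2) (hs 3 (by simp [Phi, h1, switchPhi_zero_left, h2.le]))
    rw [fderiv_sub_const] at h
    nlinarith
  · have h := inner_gradient_nonpos_of_switchPhi (hG.neg.sub_const t) (hH.sub_const t)
      (by simp [h1]) (sub_pos.2 h2) (hs 1 (by simp [Phi, h1, switchPhi_zero_left, h2.le]))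
    rw [fderiv_sub_const, fderiv_neg, neg_apply] at h
    nlinarith
  · have h := inner_gradient_nonpos_of_switchPhi (hG.neg.sub_const t) (hH.neg.sub_const t)
      (by simp [h1]) (sub_pos.2 h2) (hs 2 (by simp [Phi, h1, switchPhi_zero_left, h2.le]))
    rw [fderiv_sub_const, fderiv_neg, neg_apply] at h
    nlinarith

/-- Mirror image of `G_mul_inner_nonpos`: symmetry of φ lets `H l` be its first argument, and
quadrants 1 and 3 trade places. -/
theorem H_mul_inner_nonpos (P : MPSC n m p q) {t : ℝ} (ht : 0 < t) {l : Fin q}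
    {x d : EuclideanSpace ℝ (Fin n)} (hG : DifferentiableAt ℝ (P.G l) x)
    (hH : DifferentiableAt ℝ (P.H l) x)
    (hd : d ∈ (P.relaxed t).linearizationCone x) (hHt : |P.H l x| = t) (hGt : t < |P.G l x|) :
    P.H l x * inner ℝ (gradient (P.H l) x) d ≤ 0 := by
  have hs : ∀ s, P.Phi t s l x = 0 → inner ℝ (gradient (P.Phi t s l) x) d ≤ 0 :=
    fun s h => hd.1 (Sum.inr (s, l)) h
  rw [inner_gradient_eq_fderiv hH]
  have h0 : P.Phi t 0 l = fun y => switchPhi (P.H l y - t) (P.G l y - t) :=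
    funext fun y => switchPhi_comm _ _
  have h1' : P.Phi t 1 l = fun y => switchPhi (P.H l y - t) (-P.G l y - t) :=
    funext fun y => switchPhi_comm _ _
  have h2' : P.Phi t 2 l = fun y => switchPhi (-P.H l y - t) (-P.G l y - t) :=
    funext fun y => switchPhi_comm _ _
  have h3' : P.Phi t 3 l = fun y => switchPhi (-P.H l y - t) (P.G l y - t) :=
    funext fun y => switchPhi_comm _ _
  rcases (abs_eq ht.le).1 hHt with h1 | h1 <;> rcases lt_abs.1 hGt with h2 | h2
  · have h := hs 0 (by simp [h0, h1, switchPhi_zero_left, h2.le])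
    rw [h0] at h
    have h := inner_gradient_nonpos_of_switchPhi (hH.sub_const t) (hG.sub_const t)
      (sub_eq_zero.2 h1) (sub_pos.2 h2) h
    rw [fderiv_sub_const] at h
    nlinarith
  · have h := hs 1 (by simp [h1', h1, switchPhi_zero_left, h2.le])
    rw [h1'] at h
    have h := inner_gradient_nonpos_of_switchPhi (hH.sub_const t) (hG.neg.sub_const t)
      (sub_eq_zero.2 h1) (sub_pos.2 h2) h
    rw [fderiv_sub_const] at h
    nlinarith
  · have h := hs 3 (by simp [h3', h1, switchPhi_zero_left, h2.le])
    rw [h3'] at h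
    have h := inner_gradient_nonpos_of_switchPhi (hH.neg.sub_const t) (hG.sub_const t)
      (by simp [h1]) (sub_pos.2 h2) h
    rw [fderiv_sub_const, fderiv_neg, neg_apply] at h
    nlinarith
  · have h := hs 2 (by simp [h2', h1, switchPhi_zero_left, h2.le])
    rw [h2'] at h
    have h := inner_gradient_nonpos_of_switchPhi (hH.neg.sub_const t) (hG.neg.sub_const t)
      (by simp [h1]) (sub_pos.2 h2) h
    rw [fderiv_sub_const, fderiv_neg, neg_apply] at h
    nlinarith

/-- The constraints of the tightened problem that are active at `xbar`. -/
def tightConstraint (P : MPSC n m p q) (xbar : EuclideanSpace ℝ (Fin n)) :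
    ((P.tightened xbar).activeSet xbar) ⊕
      (Fin p ⊕ (↥(P.IG xbar ∪ P.IGH xbar) ⊕ ↥(P.IH xbar ∪ P.IGH xbar))) →
    EuclideanSpace ℝ (Fin n) → ℝ :=
  Sum.elim (fun i => P.g i) (P.tightened xbar).h

theorem IsC1.tightConstraint {P : MPSC n m p q} (hP : P.IsC1) (xbar : EuclideanSpace ℝ (Fin n)) :
    ∀ k, ContDiff ℝ 1 (P.tightConstraint xbar k) := by
  obtain ⟨-, hg, hh, hG, hH⟩ := hP
  rintro (i | j | l | l)
  exacts [hg i, hh j, hG l, hH l]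

theorem mem_IG_union_IGH {P : MPSC n m p q} {x : EuclideanSpace ℝ (Fin n)} {l : Fin q}
    (h : P.G l x = 0) : l ∈ P.IG x ∪ P.IGH x := by
  by_cases hH : P.H l x = 0
  exacts [Or.inr ⟨h, hH⟩, Or.inl ⟨h, hH⟩]

theorem mem_IH_union_IGH {P : MPSC n m p q} {x : EuclideanSpace ℝ (Fin n)} {l : Fin q}
    (h : P.H l x = 0) : l ∈ P.IH x ∪ P.IGH x := by
  by_cases hG : P.G l x = 0
  exacts [Or.inr ⟨hG, h⟩, Or.inl ⟨hG, h⟩]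

/-! ### Tangent directions of P(t) and GCQ -/

theorem mem_relaxed_feasibleSet_iff (P : MPSC n m p q) {t : ℝ}
    {x : EuclideanSpace ℝ (Fin n)} :
    x ∈ (P.relaxed t).feasibleSet ↔ (∀ i, P.g i x ≤ 0) ∧ (∀ j, P.h j x = 0) ∧
      ∀ l, |P.G l x| ≤ t ∨ |P.H l x| ≤ t := by
  simp only [← P.Phi_nonpos_iff, NLP.feasibleSet, relaxed, Set.mem_ofPred_eq, Sum.forall,
    Sum.elim_inl, Sum.elim_inr, Prod.forall]
  constructor
  · rintro ⟨⟨h1, h2⟩, h3⟩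
    exact ⟨h1, h3, fun l s => h2 s l⟩
  · rintro ⟨h1, h3, h2⟩
    exact ⟨⟨h1, fun s l => h2 l s⟩, h3⟩

/-- For each `l` it is enough that the curve stays in one branch of the disjunction. Strict
inequalities survive by continuity; tight functions belong to the independent family and so are
affine along the curve. -/
theorem IsC1.mem_bouligandCone_relaxed {P : MPSC n m p q} (hP : P.IsC1) {t : ℝ} (ht : 0 < t)
    {xbar x d : EuclideanSpace ℝ (Fin n)} (hx : x ∈ (P.relaxed t).feasibleSet)
    (hli : LinearIndependent ℝ fun k => gradient (P.tightConstraint xbar k) x)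
    (hact : ∀ i, P.g i x = 0 → P.g i xbar = 0)
    (hGbar : ∀ l, |P.G l x| = t → P.G l xbar = 0) (hHbar : ∀ l, |P.H l x| = t → P.H l xbar = 0)
    (hdg : ∀ i, P.g i x = 0 → inner ℝ (gradient (P.g i) x) d ≤ 0)
    (hdh : ∀ j, inner ℝ (gradient (P.h j) x) d = 0)
    (hdl : ∀ l, |P.G l x| < t ∨ |P.H l x| < t ∨
      (|P.G l x| = t ∧ P.G l x * inner ℝ (gradient (P.G l) x) d ≤ 0) ∨
      (|P.H l x| = t ∧ P.H l x * inner ℝ (gradient (P.H l) x) d ≤ 0)) :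
    d ∈ bouligandCone (P.relaxed t).feasibleSet x := by
  obtain ⟨z, hz0, hzd, hz⟩ := exists_curve_of_linearIndependent (hP.tightConstraint xbar) hli d
  refine mem_bouligandCone_of_curve hz0 hzd ?_
  obtain ⟨-, hg, hh, hG, hH⟩ := hP
  rw [P.mem_relaxed_feasibleSet_iff] at hx
  have hzx : Tendsto z (𝓝[>] 0) (𝓝 x) := by
    have h := hzd.continuousAt.tendsto
    rw [hz0] at h
    exact h.mono_left nhdsWithin_le_nhds
  have hz' : ∀ᶠ τ in 𝓝[>] (0 : ℝ), ∀ k, P.tightConstraint xbar k (z τ) =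
      P.tightConstraint xbar k x + τ * inner ℝ (gradient (P.tightConstraint xbar k) x) d :=
    nhdsWithin_le_nhds hz
  simp only [P.mem_relaxed_feasibleSet_iff]
  refine Eventually.and (eventually_all.2 fun i => ?_)
    (Eventually.and ?_ (eventually_all.2 fun l => ?_))
  · rcases (hx.1 i).eq_or_lt with h | h
    · filter_upwards [hz', self_mem_nhdsWithin] with τ h1 h2
      have h3 := h1 (Sum.inl ⟨i, hact i h⟩)
      change P.g i (z τ) = P.g i x + τ * inner ℝ (gradient (P.g i) x) d at h3
      rw [h3, h, zero_add]
      exact mul_nonpos_of_nonneg_of_nonpos (le_of_lt h2) (hdg i h)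
    · filter_upwards [((hg i).continuous.continuousAt.tendsto.comp hzx).eventually
        (gt_mem_nhds h)] with τ h1 using le_of_lt h1
  · filter_upwards [hz'] with τ h1 j
    have h3 := h1 (Sum.inr (Sum.inl j))
    change P.h j (z τ) = P.h j x + τ * inner ℝ (gradient (P.h j) x) d at h3
    rw [h3, hx.2.1 j, hdh j, mul_zero, zero_add]
  · rcases hdl l with h | h | ⟨h, h'⟩ | ⟨h, h'⟩
    · filter_upwards [((hG l).continuous.abs.continuousAt.tendsto.comp hzx).eventually
        (gt_mem_nhds h)] with τ h1 using Or.inl (le_of_lt h1)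
    · filter_upwards [((hH l).continuous.abs.continuousAt.tendsto.comp hzx).eventually
        (gt_mem_nhds h)] with τ h1 using Or.inr (le_of_lt h1)
    · filter_upwards [hz', eventually_abs_add_mul_le ht h h'] with τ h1 h2
      have h3 := h1 (Sum.inr (Sum.inr (Sum.inl ⟨l, mem_IG_union_IGH (hGbar l h)⟩)))
      change P.G l (z τ) = P.G l x + τ * inner ℝ (gradient (P.G l) x) d at h3
      exact Or.inl (h3 ▸ h2)
    · filter_upwards [hz', eventually_abs_add_mul_le ht h h'] with τ h1 h2
      have h3 := h1 (Sum.inr (Sum.inr (Sum.inr ⟨l, mem_IH_union_IGH (hHbar l h)⟩)))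
      change P.H l (z τ) = P.H l x + τ * inner ℝ (gradient (P.H l) x) d at h3
      exact Or.inr (h3 ▸ h2)

/-- GCQ for the relaxed problem at a feasible point where the gradients of the constraints tight
at `xbar` are linearly independent and all active constraints at `x` stem from those. -/
theorem IsC1.gcq_relaxed {P : MPSC n m p q} (hP : P.IsC1) {t : ℝ} (ht : 0 < t)
    {xbar x : EuclideanSpace ℝ (Fin n)} (hx : x ∈ (P.relaxed t).feasibleSet)
    (hli : LinearIndependent ℝ fun k => gradient (P.tightConstraint xbar k) x)
    (hact : ∀ i, P.g i x = 0 → P.g i xbar = 0)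
    (hGbar : ∀ l, |P.G l x| = t → P.G l xbar = 0)
    (hHbar : ∀ l, |P.H l x| = t → P.H l xbar = 0) :
    (P.relaxed t).GCQ x := by
  classical
  have hdG : ∀ l, DifferentiableAt ℝ (P.G l) x := fun l => (hP.2.2.2.1 l).differentiable one_ne_zero x
  have hdH : ∀ l, DifferentiableAt ℝ (P.H l) x := fun l => (hP.2.2.2.2 l).differentiable one_ne_zero x
  refine Set.Subset.antisymm (fun y hy d hd => ?_)
    (polarCone_anti (bouligandCone_subset_linearizationCone _ hx ?_
      fun j => (hP.2.2.1 j).differentiable one_ne_zero x))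
  -- `v` is nonzero only on corner indices. The signs make `d + v` annihilate `∇G l` and `d - v`
  -- annihilate `∇H l`, so the two directions follow different branches at each corner.
  · obtain ⟨v, hv⟩ := exists_inner_eq_of_linearIndependent hli (Sum.elim 0 (Sum.elim 0 (Sum.elim
      (fun l => if |P.G l x| = t ∧ |P.H l x| = t then -inner ℝ (gradient (P.G l) x) d else 0)
      (fun l => if |P.G l x| = t ∧ |P.H l x| = t then inner ℝ (gradient (P.H l) x) d else 0))))
    have hvg : ∀ i, P.g i x = 0 → inner ℝ (gradient (P.g i) x) v = 0 :=
      fun i hi => hv (Sum.inl ⟨i, hact i hi⟩)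
    have hvh : ∀ j, inner ℝ (gradient (P.h j) x) v = 0 := fun j => hv (Sum.inr (Sum.inl j))
    have hvG : ∀ l, |P.G l x| = t → inner ℝ (gradient (P.G l) x) v =
        if |P.G l x| = t ∧ |P.H l x| = t then -inner ℝ (gradient (P.G l) x) d else 0 :=
      fun l hl => hv (Sum.inr (Sum.inr (Sum.inl ⟨l, mem_IG_union_IGH (hGbar l hl)⟩)))
    have hvH : ∀ l, |P.H l x| = t → inner ℝ (gradient (P.H l) x) v =
        if |P.G l x| = t ∧ |P.H l x| = t then inner ℝ (gradient (P.H l) x) d else 0 :=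
      fun l hl => hv (Sum.inr (Sum.inr (Sum.inr ⟨l, mem_IH_union_IGH (hHbar l hl)⟩)))
    have hdg : ∀ i, P.g i x = 0 → inner ℝ (gradient (P.g i) x) d ≤ 0 :=
      fun i hi => hd.1 (Sum.inl i) hi
    have hdh : ∀ j, inner ℝ (gradient (P.h j) x) d = 0 := hd.2
    have hcases : ∀ l, |P.G l x| < t ∨ |P.H l x| < t ∨ (|P.G l x| = t ∧ t < |P.H l x|) ∨
        (|P.H l x| = t ∧ t < |P.G l x|) ∨ (|P.G l x| = t ∧ |P.H l x| = t) := fun l => by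
      have := ((P.mem_relaxed_feasibleSet_iff).1 hx).2.2 l
      grind
    have h1 : d + v ∈ bouligandCone (P.relaxed t).feasibleSet x := by
      refine hP.mem_bouligandCone_relaxed ht hx hli hact hGbar hHbar (fun i hi => ?_) (fun j => ?_)
        fun l => ?_
      · rw [inner_add_right, hvg i hi, add_zero]; exact hdg i hi
      · rw [inner_add_right, hvh, hdh, add_zero]
      · rcases hcases l with h | h | ⟨h, h'⟩ | ⟨h, h'⟩ | ⟨h, h'⟩
        · exact Or.inl h
        · exact Or.inr (Or.inl h)
        · refine Or.inr (Or.inr (Or.inl ⟨h, ?_⟩))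
          rw [inner_add_right, hvG l h, if_neg fun hc => h'.ne' hc.2, add_zero]
          exact P.G_mul_inner_nonpos ht (hdG l) (hdH l) hd h h'
        · refine Or.inr (Or.inr (Or.inr ⟨h, ?_⟩))
          rw [inner_add_right, hvH l h, if_neg fun hc => h'.ne' hc.1, add_zero]
          exact P.H_mul_inner_nonpos ht (hdG l) (hdH l) hd h h'
        · refine Or.inr (Or.inr (Or.inl ⟨h, ?_⟩))
          rw [inner_add_right, hvG l h, if_pos ⟨h, h'⟩, add_neg_cancel, mul_zero]
    have h2 : d - v ∈ bouligandCone (P.relaxed t).feasibleSet x := by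
      refine hP.mem_bouligandCone_relaxed ht hx hli hact hGbar hHbar (fun i hi => ?_) (fun j => ?_)
        fun l => ?_
      · rw [inner_sub_right, hvg i hi, sub_zero]; exact hdg i hi
      · rw [inner_sub_right, hvh, hdh, sub_zero]
      · rcases hcases l with h | h | ⟨h, h'⟩ | ⟨h, h'⟩ | ⟨h, h'⟩
        · exact Or.inl h
        · exact Or.inr (Or.inl h)
        · refine Or.inr (Or.inr (Or.inl ⟨h, ?_⟩))
          rw [inner_sub_right, hvG l h, if_neg fun hc => h'.ne' hc.2, sub_zero]
          exact P.G_mul_inner_nonpos ht (hdG l) (hdH l) hd h h'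
        · refine Or.inr (Or.inr (Or.inr ⟨h, ?_⟩))
          rw [inner_sub_right, hvH l h, if_neg fun hc => h'.ne' hc.1, sub_zero]
          exact P.H_mul_inner_nonpos ht (hdG l) (hdH l) hd h h'
        · refine Or.inr (Or.inr (Or.inr ⟨h', ?_⟩))
          rw [inner_sub_right, hvH l h', if_pos ⟨h, h'⟩, sub_self, mul_zero]
    -- Adding the two polar inequalities cancels `v` and leaves twice the inequality for `d`.
    have h3 := hy _ h1
    have h4 := hy _ h2
    rw [inner_add_left] at h3
    rw [inner_sub_left] at h4
    linarith
  · rintro (i | ⟨s, l⟩) hi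
    · exact (hP.2.1 i).differentiable one_ne_zero x
    · exact P.differentiableAt_Phi (hdG l) (hdH l) hi

/-- A positive threshold below which a nonvanishing continuous function stays away from zero. -/
theorem eventually_forall_lt_abs {u : Fin q → EuclideanSpace ℝ (Fin n) → ℝ}
    (hu : ∀ l, Continuous (u l)) (xbar : EuclideanSpace ℝ (Fin n)) :
    ∀ᶠ tbar in 𝓝[>] (0 : ℝ), ∀ᶠ x in 𝓝 xbar, ∀ l, u l xbar ≠ 0 → tbar < |u l x| := by
  have h : ∀ᶠ tbar in 𝓝[>] (0 : ℝ), ∀ l, u l xbar ≠ 0 → tbar < |u l xbar| := by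
    refine eventually_all.2 fun l => ?_
    by_cases hl : u l xbar = 0
    · exact Eventually.of_forall fun _ h => absurd hl h
    · filter_upwards [nhdsWithin_le_nhds (gt_mem_nhds (abs_pos.2 hl))] with τ hτ _ using hτ
  filter_upwards [h] with tbar ht
  refine eventually_all.2 fun l => ?_
  by_cases hl : u l xbar = 0
  · exact Eventually.of_forall fun _ h => absurd hl h
  · filter_upwards [(hu l).abs.continuousAt.eventually (lt_mem_nhds (ht l hl))] with x hx _ using hx

end MPSC

/-! ### The choice of threshold and neighborhood -/

theorem mainTheorem2 {n m p q : ℕ} (P : MPSC n m p q) (hP : P.IsC1)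
    (xbar : EuclideanSpace ℝ (Fin n)) (hx : xbar ∈ P.feasibleSet) (hLICQ : P.MPSCLICQ xbar) :
    ∃ tbar : ℝ, 0 < tbar ∧ ∃ U ∈ 𝓝 xbar, ∀ t : ℝ, 0 < t → t ≤ tbar →
      ∀ x ∈ (P.relaxed t).feasibleSet ∩ U, (P.relaxed t).GCQ x := by
  have hli : LinearIndependent ℝ fun k => gradient (P.tightConstraint xbar k) xbar := by
    have h : (P.tightened xbar).LICQ xbar := hLICQ
    rw [NLP.LICQ] at h
    convert h using 1
    funext k
    rcases k with i | j <;> rfl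
  have hli' := eventually_linearIndependent_gradient (hP.tightConstraint xbar) hli
  have hg : ∀ᶠ x in 𝓝 xbar, ∀ i, P.g i x = 0 → P.g i xbar = 0 := by
    refine eventually_all.2 fun i => ?_
    rcases (hx.1 i).eq_or_lt with h | h
    · exact Eventually.of_forall fun _ _ => h
    · filter_upwards [(hP.2.1 i).continuous.continuousAt.eventually (gt_mem_nhds h)] with x hx h0
      exact absurd h0 hx.ne
  -- `tbar` lies below every nonzero `|G l xbar|` and `|H l xbar|`, and the strict gap persists near
  -- `xbar`. Thus `|G l x| = t ≤ tbar` forces `G l xbar = 0`, and likewise for `H`.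
  obtain ⟨tbar, ⟨hG, hH⟩, htpos⟩ :=
    (((MPSC.eventually_forall_lt_abs (fun l => (hP.2.2.2.1 l).continuous) xbar).and
      (MPSC.eventually_forall_lt_abs (fun l => (hP.2.2.2.2 l).continuous) xbar)).and
      self_mem_nhdsWithin).exists
  refine ⟨tbar, htpos, _, (hli'.and (hg.and (hG.and hH))), ?_⟩
  rintro t ht htt x ⟨hxf, hxli, hxg, hxG, hxH⟩
  refine hP.gcq_relaxed ht hxf hxli hxg (fun l hl => ?_) (fun l hl => ?_)
  · by_contra h
    exact absurd (hxG l h) (by rw [hl]; exact not_lt.2 htt)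
  · by_contra h
    exact absurd (hxH l h) (by rw [hl]; exact not_lt.2 htt)
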